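/- Let $\mathcal X,\mathcal Y,\hat{\mathcal X}$ be finite non-empty alphabets, $P_{XY}$ a pmf on $\mathcal X\times\mathcal Y$, and $d:\mathcal X\times\hat{\mathcal X}\to[0,\infty)$. Let $(X_i,Y_i)_{i\ge1}$ be i.i.d. with law $P_{XY}$, and for $n\ge 1$ put $\bar d(x^n,\hat x^n)=\frac1n\sum_{i=1}^n d(x_i,\hat x_i)$. For a rate $R\ge0$ and a distortion level $\Delta$ let $$p_{\mathrm c}(n,R,\Delta)=\max_{f_n,g_n}\mathbb P\{\bar d(X^n,g_n(f_n(Y^n)))\le\Delta\},$$ where the maximum is over all $f_n:\mathcal Y^n\to\{1,\dots,\lfloor 2^{nR}\rfloor\}$ and $g_n:\{1,\dots,\lfloor 2^{nR}\rfloor\}\to\hat{\mathcal X}^n$. Let $$R_{\mathrm r}(P_{XY},\Delta)=\min_{P_{\hat X|Y}:\ \mathbb E[d(X,\hat X)]\le\Delta} I(Y;\hat X),$$ where $(X,Y,\hat X)$ has law $P_{XY}P_{\hat X|Y}$ and information is measured in bits. Fix $\Delta\ge\Delta_{\min}:=\min_{\varphi:\mathcal Y\to\hat{\mathcal X}}\mathbb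 E[d(X,\varphi(Y))]$. Then for every $R\ge0$ we have $p_{\mathrm c}(n,R,\Delta)>0$ for all $n\ge1$, and the limit $$E(R,\Delta)=\lim_{n\to\infty}-\frac1n\log_2 p_{\mathrm c}(n,R,\Delta)$$ exists and is finite. The function $R\mapsto E(R,\Delta)$ is continuous on $[0,\infty)$; in fact $|E(R_1,\Delta)-E(R_2,\Delta)|\le|R_1-R_2|$ for all $R_1,R_2\ge0$. Moreover $E(R,\Delta)>0$ for every rate $0\le R<R_{\mathrm r}(P_{XY},\Delta)$. -/

import Mathlib

open Filter Topology

noncomputable section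

namespace RemoteCoding

variable {X Y Xh : Type*} [Fintype X] [Fintype Y] [Fintype Xh]

/-- Per-letter distortion between two sequences of length `n`. -/
def avgDist (d : X → Xh → ℝ) {n : ℕ} (x : Fin n → X) (xh : Fin n → Xh) : ℝ :=
  (1 / (n : ℝ)) * ∑ i, d (x i) (xh i)

/-- The number of messages available at rate `R` and blocklength `n`: the integer part of
`2 ^ (n R)`. -/
def numMessages (n : ℕ) (R : ℝ) : ℕ := ⌊(2 : ℝ) ^ ((n : ℝ) * R)⌋₊

/-- The probability, when the pairs `(X_i, Y_i)` are i.i.d. with law `P`, that encoding `Y^n` by `f`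
and decoding by `g` gives a reconstruction of `X^n` within distortion `Δ`. -/
def successProb (P : X × Y → ℝ) (d : X → Xh → ℝ) (Δ : ℝ) {n M : ℕ}
    (f : (Fin n → Y) → Fin M) (g : Fin M → (Fin n → Xh)) : ℝ :=
  ∑ x : Fin n → X, ∑ y : Fin n → Y,
    if avgDist d x (g (f y)) ≤ Δ then ∏ i, P (x i, y i) else 0

/-- Maximal correct reconstruction probability; a maximum over the finite set of all pairs of an
encoder and a decoder. -/
def pc (P : X × Y → ℝ) (d : X → Xh → ℝ) (n : ℕ) (R Δ : ℝ) : ℝ :=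
  ⨆ c : ((Fin n → Y) → Fin (numMessages n R)) × (Fin (numMessages n R) → (Fin n → Xh)),
    successProb P d Δ c.1 c.2

/-- `-(1/n) log₂ p_c(n, R, Δ)`. -/
def exponentSeq (P : X × Y → ℝ) (d : X → Xh → ℝ) (R Δ : ℝ) (n : ℕ) : ℝ :=
  -(1 / (n : ℝ)) * Real.logb 2 (pc P d n R Δ)

/-- The exponent `E(R, Δ)`, the limit of `-(1/n) log₂ p_c(n, R, Δ)`. -/
def exponent (P : X × Y → ℝ) (d : X → Xh → ℝ) (R Δ : ℝ) : ℝ :=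
  limUnder atTop (exponentSeq P d R Δ)

/-- The least expected distortion over all maps from observations to reconstructions. -/
def deltaMin (P : X × Y → ℝ) (d : X → Xh → ℝ) : ℝ :=
  ⨅ φ : Y → Xh, ∑ x, ∑ y, P (x, y) * d x (φ y)

/-- Mutual information, in bits, of the two coordinates of a pmf `q` on a product. Terms with
`q (a, b) = 0` vanish, and `q (a, b) > 0` forces both marginals to be positive. -/
def mutualInfo {A B : Type*} [Fintype A] [Fintype B] (q : A × B → ℝ) : ℝ :=
  ∑ a, ∑ b, q (a, b) * Real.logb 2 (q (a, b) / ((∑ b', q (a, b')) * (∑ a', q (a', b))))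

/-- The conditional pmfs `W = P_{X̂|Y}` (as `W y xh`) for which, under `P_{XY} P_{X̂|Y}`, the expected
distortion is at most `Δ`. -/
def feasibleChannels (P : X × Y → ℝ) (d : X → Xh → ℝ) (Δ : ℝ) : Set (Y → Xh → ℝ) :=
  {W | (∀ y, W y ∈ stdSimplex ℝ Xh) ∧ ∑ x, ∑ y, ∑ xh, P (x, y) * W y xh * d x xh ≤ Δ}

/-- The joint pmf of `(Y, X̂)` under `P_{XY} P_{X̂|Y}`. -/
def jointYXh (P : X × Y → ℝ) (W : Y → Xh → ℝ) : Y × Xh → ℝ :=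
  fun p => (∑ x, P (x, p.1)) * W p.1 p.2

/-- The remote rate-distortion function: the least `I(Y; X̂)` over the feasible channels. -/
def remoteRateDistortion (P : X × Y → ℝ) (d : X → Xh → ℝ) (Δ : ℝ) : ℝ :=
  sInf ((fun W => mutualInfo (jointYXh P W)) '' feasibleChannels P d Δ)

end RemoteCoding

end

/-! ### Codes at a fixed block length -/

namespace RemoteCoding

variable {X Y Xh : Type*} [Fintype X] [Fintype Y] [Fintype Xh]

/-! Existence of the limit is Fekete's lemma: concatenating codes makes -log p_c subadditive
(`pc_mul_le`), and it is nonnegative. For the Lipschitz bound, the messages at the larger rate R₂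
are cut into about 2^{n(R₂-R₁)} blocks of rate-R₁ size, one of which keeps its share of the success
probability (`pc_le_mul_pc`).

Positivity is a change of measure. Condition the i.i.d. law on success of an optimal code and
average over positions, obtaining a law q of one triple (x, y, x̂). Conditioning shifts the
log-likelihood by exactly -log p_c, so Gibbs' inequality against two product-form block measures
gives single-letter bounds: the divergence of q from P_XY q_{X̂|Y} is at most -(1/n) log p_c
(`letterLaw_divergence_le`), and that of q_{YX̂} from P_Y q_X̂ is at most R - (1/n) log p_c
(`letterLaw_information_le`). If E(R, Δ) = 0, compactness yields a limiting q with vanishing first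
divergence; the equality case of Gibbs makes q = P_XY W for a feasible channel W with I(Y; X̂) ≤ R,
whence R_r ≤ R (`remoteRateDistortion_le`). -/

/-- The probability that the reconstruction `φ (Y^n)` of `X^n` is within distortion `Δ`. -/
noncomputable def reconProb (P : X × Y → ℝ) (d : X → Xh → ℝ) (Δ : ℝ) {n : ℕ}
    (φ : (Fin n → Y) → (Fin n → Xh)) : ℝ :=
  ∑ x : Fin n → X, ∑ y : Fin n → Y, if avgDist d x (φ y) ≤ Δ then ∏ i, P (x i, y i) else 0

theorem numMessages_pos (n : ℕ) {R : ℝ} (hR : 0 ≤ R) : 0 < numMessages n R := by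
  refine Nat.floor_pos.2 (Real.one_le_rpow (by norm_num) (by positivity))

theorem numMessages_le (n : ℕ) (R : ℝ) : (numMessages n R : ℝ) ≤ 2 ^ ((n : ℝ) * R) :=
  Nat.floor_le (by positivity)

/-- For t ≥ 1 rounding down loses at most a factor 2, which disappears in the exponent. -/
theorem rpow_le_two_mul_numMessages (n : ℕ) {R : ℝ} (hR : 0 ≤ R) :
    (2 : ℝ) ^ ((n : ℝ) * R) ≤ 2 * numMessages n R := by
  have h1 : (1 : ℝ) ≤ numMessages n R := by exact_mod_cast numMessages_pos n hR
  have h2 : (2 : ℝ) ^ ((n : ℝ) * R) < numMessages n R + 1 := Nat.lt_floor_add_one _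
  linarith

theorem numMessages_mul_le (m n : ℕ) (R : ℝ) :
    numMessages m R * numMessages n R ≤ numMessages (m + n) R := by
  refine Nat.le_floor ?_
  push_cast
  rw [add_mul, Real.rpow_add (by norm_num)]
  exact mul_le_mul (numMessages_le m R) (numMessages_le n R) (by positivity) (by positivity)

theorem numMessages_mono (n : ℕ) {R₁ R₂ : ℝ} (h : R₁ ≤ R₂) :
    numMessages n R₁ ≤ numMessages n R₂ := by
  refine Nat.floor_le_floor (Real.rpow_le_rpow_of_exponent_le (by norm_num) (by gcongr))

variable {P : X × Y → ℝ} {d : X → Xh → ℝ} {Δ : ℝ}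

theorem sum_sum_prod_eq_one (hP : P ∈ stdSimplex ℝ (X × Y)) (n : ℕ) :
    ∑ x : Fin n → X, ∑ y : Fin n → Y, ∏ i, P (x i, y i) = 1 := by
  classical
  have h : ∀ x : Fin n → X, ∑ y : Fin n → Y, ∏ i, P (x i, y i) = ∏ i, ∑ b, P (x i, b) := by
    intro x
    rw [Finset.prod_univ_sum, Fintype.piFinset_univ]
  simp_rw [h]
  have := Finset.prod_univ_sum (fun _ : Fin n => (Finset.univ : Finset X))
    (fun _ a => ∑ b, P (a, b))
  rw [Fintype.piFinset_univ] at this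
  rw [← this, ← Fintype.sum_prod_type, hP.2]
  simp

omit [Fintype Xh] in
theorem reconProb_le_one (hP : P ∈ stdSimplex ℝ (X × Y)) {n : ℕ}
    (φ : (Fin n → Y) → (Fin n → Xh)) : reconProb P d Δ φ ≤ 1 := by
  rw [← sum_sum_prod_eq_one hP n]
  refine Finset.sum_le_sum fun x _ => Finset.sum_le_sum fun y _ => ?_
  split_ifs
  · exact le_rfl
  · exact Finset.prod_nonneg fun i _ => hP.1 _

theorem exists_reconProb_eq_pc [Nonempty Xh] (n : ℕ) {R : ℝ} (hR : 0 ≤ R) :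
    ∃ (f : (Fin n → Y) → Fin (numMessages n R)) (g : Fin (numMessages n R) → (Fin n → Xh)),
      reconProb P d Δ (fun y => g (f y)) = pc P d n R Δ := by
  classical
  have : NeZero (numMessages n R) := ⟨(numMessages_pos n hR).ne'⟩
  obtain ⟨c, hc⟩ := exists_eq_ciSup_of_finite
    (f := fun c : ((Fin n → Y) → Fin (numMessages n R)) × (Fin (numMessages n R) → (Fin n → Xh)) =>
      successProb P d Δ c.1 c.2)
  exact ⟨c.1, c.2, hc⟩

/-- A reconstruction that factors through few enough messages is a code. -/
theorem reconProb_le_pc [Nonempty Xh] {n : ℕ} {R : ℝ} {ι : Type*} [Fintype ι]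
    (hι : Fintype.card ι ≤ numMessages n R) (f : (Fin n → Y) → ι) (g : ι → (Fin n → Xh)) :
    reconProb P d Δ (fun y => g (f y)) ≤ pc P d n R Δ := by
  classical
  obtain ⟨e⟩ : Nonempty (ι ↪ Fin (numMessages n R)) :=
    Function.Embedding.nonempty_of_card_le (by simpa using hι)
  have h := le_ciSup (f := fun c : ((Fin n → Y) → Fin (numMessages n R)) ×
      (Fin (numMessages n R) → (Fin n → Xh)) => successProb P d Δ c.1 c.2)
      (Set.finite_range _).bddAbove
      (fun y => e (f y), Function.extend e g (fun _ _ => Classical.arbitrary Xh))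
  refine le_trans (le_of_eq ?_) h
  simp [successProb, reconProb, e.injective.extend_apply]

theorem pc_le_one [Nonempty Xh] (hP : P ∈ stdSimplex ℝ (X × Y)) (n : ℕ) {R : ℝ} (hR : 0 ≤ R) :
    pc P d n R Δ ≤ 1 := by
  obtain ⟨f, g, h⟩ := exists_reconProb_eq_pc (P := P) (d := d) (Δ := Δ) n hR
  exact h ▸ reconProb_le_one hP _

/-- Otherwise every reconstruction letter exceeds Δ on the support of P, and so does the mean
distortion of a minimising φ. -/
theorem exists_pos_of_deltaMin_le [Nonempty Xh] (hP : P ∈ stdSimplex ℝ (X × Y))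
    (hΔ : deltaMin P d ≤ Δ) : ∃ x y xh, 0 < P (x, y) ∧ d x xh ≤ Δ := by
  classical
  obtain ⟨φ, hφ⟩ := exists_eq_ciInf_of_finite
    (f := fun φ : Y → Xh => ∑ x, ∑ y, P (x, y) * d x (φ y))
  by_contra! hcon
  have hφ' : ∑ p : X × Y, P p * d p.1 (φ p.2) ≤ Δ := by
    rw [Fintype.sum_prod_type]
    exact hφ.trans_le hΔ
  have hlt : ∑ p : X × Y, P p * Δ < ∑ p : X × Y, P p * d p.1 (φ p.2) := by
    obtain ⟨p, -, hp⟩ : ∃ p ∈ Finset.univ, P p ≠ 0 := by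
      refine Finset.exists_ne_zero_of_sum_ne_zero ?_
      rw [hP.2]
      exact one_ne_zero
    refine Finset.sum_lt_sum (fun p _ => ?_) ⟨p, Finset.mem_univ _, ?_⟩
    · rcases (hP.1 p).eq_or_lt with h | h
      · simp [← h]
      · exact mul_le_mul_of_nonneg_left (hcon _ _ _ h).le h.le
    · have h := lt_of_le_of_ne (hP.1 p) (Ne.symm hp)
      exact mul_lt_mul_of_pos_left (hcon _ _ _ h) h
  rw [← Finset.sum_mul, hP.2] at hlt
  linarith

omit [Fintype X] [Fintype Xh] in
theorem avgDist_le_iff {n : ℕ} (hn : 0 < n) (x : Fin n → X) (xh : Fin n → Xh) :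
    avgDist d x xh ≤ Δ ↔ ∑ i, d (x i) (xh i) ≤ n * Δ := by
  have : (0 : ℝ) < n := by exact_mod_cast hn
  rw [avgDist, one_div, inv_mul_le_iff₀ this]

omit [Fintype X] [Fintype Xh] in
theorem sum_le_of_avgDist_le {n : ℕ} {x : Fin n → X} {xh : Fin n → Xh}
    (h : avgDist d x xh ≤ Δ) : ∑ i, d (x i) (xh i) ≤ n * Δ := by
  rcases n.eq_zero_or_pos with rfl | hn
  · simp
  · exact (avgDist_le_iff hn x xh).1 h

theorem pc_pos [Nonempty Xh] (hP : P ∈ stdSimplex ℝ (X × Y)) (hd : ∀ x xh, 0 ≤ d x xh)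
    (hΔ : deltaMin P d ≤ Δ) (n : ℕ) {R : ℝ} (hR : 0 ≤ R) : 0 < pc P d n R Δ := by
  classical
  obtain ⟨x, y, xh, hp, hle⟩ := exists_pos_of_deltaMin_le hP hΔ
  -- A single message suffices: always reconstruct the constant sequence of the good letter, and
  -- keep only the constant source block.
  refine lt_of_lt_of_le ?_ (reconProb_le_pc (ι := Unit) (by simpa using Nat.succ_le_of_lt (numMessages_pos n hR))
    (fun _ => ()) (fun _ _ => xh))
  have hterm : ∀ (u : Fin n → X) (v : Fin n → Y),
      0 ≤ if avgDist d u (fun _ => xh) ≤ Δ then ∏ i, P (u i, v i) else 0 := by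
    intro u v
    split_ifs
    · exact Finset.prod_nonneg fun i _ => hP.1 _
    · exact le_rfl
  have havg : avgDist d (fun _ : Fin n => x) (fun _ => xh) ≤ Δ := by
    rcases n.eq_zero_or_pos with rfl | hn
    -- The empty block has average distortion 0, so 0 ≤ d x xh ≤ Δ is what is needed.
    · simpa [avgDist] using (hd x xh).trans hle
    · rw [avgDist_le_iff hn]
      simp only [Finset.sum_const, Finset.card_univ, Fintype.card_fin, nsmul_eq_mul]
      gcongr
  refine Finset.sum_pos' (fun u _ => Finset.sum_nonneg fun v _ => hterm u v)
    ⟨fun _ => x, Finset.mem_univ _, Finset.sum_pos' (fun v _ => hterm _ v)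
      ⟨fun _ => y, Finset.mem_univ _, ?_⟩⟩
  rw [if_pos havg]
  exact Finset.prod_pos fun i _ => hp

omit [Fintype X] [Fintype Xh] in
theorem avgDist_append_le {m n : ℕ} {x₁ : Fin m → X} {x₂ : Fin n → X} {z₁ : Fin m → Xh}
    {z₂ : Fin n → Xh} (h₁ : avgDist d x₁ z₁ ≤ Δ) (h₂ : avgDist d x₂ z₂ ≤ Δ) :
    avgDist d (Fin.append x₁ x₂) (Fin.append z₁ z₂) ≤ Δ := by
  rcases (m + n).eq_zero_or_pos with h | h
  · obtain ⟨rfl, rfl⟩ := Nat.add_eq_zero_iff.1 h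
    simpa [avgDist] using h₁
  · have hs₁ := sum_le_of_avgDist_le h₁
    have hs₂ := sum_le_of_avgDist_le h₂
    rw [avgDist_le_iff h, Fin.sum_univ_add]
    simp only [Fin.append_left, Fin.append_right]
    push_cast
    linarith

theorem sum_append {α : Type*} [Fintype α] {m n : ℕ} (F : (Fin (m + n) → α) → ℝ) :
    ∑ x, F x = ∑ x₁ : Fin m → α, ∑ x₂ : Fin n → α, F (Fin.append x₁ x₂) := by
  rw [← Fintype.sum_prod_type', ← (Fin.appendEquiv m n).sum_comp]
  rfl

/-- Run optimal codes on the two halves. Pairs of messages fit into the longer code's budget,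
success on both halves implies success on the whole, and the product law factorises. -/
theorem pc_mul_le [Nonempty Xh] (hP : ∀ p, 0 ≤ P p) (m n : ℕ) {R : ℝ} (hR : 0 ≤ R) :
    pc P d m R Δ * pc P d n R Δ ≤ pc P d (m + n) R Δ := by
  classical
  obtain ⟨f₁, g₁, h₁⟩ := exists_reconProb_eq_pc (P := P) (d := d) (Δ := Δ) m hR
  obtain ⟨f₂, g₂, h₂⟩ := exists_reconProb_eq_pc (P := P) (d := d) (Δ := Δ) n hR
  rw [← h₁, ← h₂]
  refine le_trans ?_ (reconProb_le_pc
    (ι := Fin (numMessages m R) × Fin (numMessages n R))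
    (by simpa using numMessages_mul_le m n R)
    (fun y => (f₁ (fun i => y (Fin.castAdd n i)), f₂ (fun i => y (Fin.natAdd m i))))
    (fun c => Fin.append (g₁ c.1) (g₂ c.2)))
  simp only [reconProb]
  rw [sum_append, Finset.sum_mul_sum]
  refine Finset.sum_le_sum fun x₁ _ => Finset.sum_le_sum fun x₂ _ => ?_
  rw [sum_append, Finset.sum_mul_sum]
  refine Finset.sum_le_sum fun y₁ _ => Finset.sum_le_sum fun y₂ _ => ?_
  simp only [Fin.append_left, Fin.append_right, Fin.prod_univ_add]
  have hpos : 0 ≤ (∏ i, P (x₁ i, y₁ i)) * ∏ i, P (x₂ i, y₂ i) :=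
    mul_nonneg (Finset.prod_nonneg fun i _ => hP _) (Finset.prod_nonneg fun i _ => hP _)
  by_cases c₁ : avgDist d x₁ (g₁ (f₁ y₁)) ≤ Δ
  · by_cases c₂ : avgDist d x₂ (g₂ (f₂ y₂)) ≤ Δ
    · rw [if_pos c₁, if_pos c₂, if_pos (avgDist_append_le c₁ c₂)]
    · rw [if_neg c₂, mul_zero]
      split_ifs
      · exact hpos
      · exact le_rfl
  · rw [if_neg c₁, zero_mul]
    split_ifs
    · exact hpos
    · exact le_rfl

theorem pc_mono [Nonempty Xh] (n : ℕ) {R₁ R₂ : ℝ} (hR : 0 ≤ R₁) (h : R₁ ≤ R₂) :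
    pc P d n R₁ Δ ≤ pc P d n R₂ Δ := by
  obtain ⟨f, g, h₁⟩ := exists_reconProb_eq_pc (P := P) (d := d) (Δ := Δ) n hR
  rw [← h₁]
  exact reconProb_le_pc (by simpa using numMessages_mono n h) f g

/-- Splitting the messages into blocks and keeping the best block. -/
theorem pc_le_mul_pc [Nonempty Xh] (hP : ∀ p, 0 ≤ P p) (n : ℕ) {R₁ R₂ : ℝ} (hR₁ : 0 ≤ R₁)
    (hR₂ : 0 ≤ R₂) :
    pc P d n R₂ Δ ≤ (numMessages n R₂ / numMessages n R₁ + 1 : ℕ) * pc P d n R₁ Δ := by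
  classical
  obtain ⟨f, g, h⟩ := exists_reconProb_eq_pc (P := P) (d := d) (Δ := Δ) n hR₂
  rw [← h]
  set M₁ := numMessages n R₁ with hM₁
  have hpos : 0 < M₁ := numMessages_pos n hR₁
  -- The extra block covers an incomplete last one.
  let K := numMessages n R₂ / M₁ + 1
  -- The code for block `a` sends only the remainder mod `M₁`; its decoder takes the quotient to be
  -- `a`, which is right exactly when the message lies in that block.
  let φ : ℕ → (Fin n → Y) → (Fin n → Xh) := fun a y =>
    if h : a * M₁ + (f y : ℕ) % M₁ < numMessages n R₂ then g ⟨a * M₁ + (f y : ℕ) % M₁, h⟩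
    else fun _ => Classical.arbitrary Xh
  have hφ : ∀ a, reconProb P d Δ (φ a) ≤ pc P d n R₁ Δ := fun a =>
    reconProb_le_pc (ι := Fin M₁) (by simp [hM₁])
      (fun y => ⟨(f y : ℕ) % M₁, Nat.mod_lt _ hpos⟩)
      (fun j => if h : a * M₁ + (j : ℕ) < numMessages n R₂ then g ⟨a * M₁ + (j : ℕ), h⟩
        else fun _ => Classical.arbitrary Xh)
  have hcover : reconProb P d Δ (fun y => g (f y)) ≤
      ∑ a ∈ Finset.range K, reconProb P d Δ (φ a) := by
    simp only [reconProb]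
    rw [Finset.sum_comm (s := Finset.range K)]
    refine Finset.sum_le_sum fun x _ => ?_
    rw [Finset.sum_comm (s := Finset.range K)]
    refine Finset.sum_le_sum fun y _ => ?_
    have hmem : (f y : ℕ) / M₁ ∈ Finset.range K :=
      Finset.mem_range.2 (Nat.lt_succ_of_le (Nat.div_le_div_right (f y).2.le))
    have heq : φ ((f y : ℕ) / M₁) y = g (f y) := by
      have e : (f y : ℕ) / M₁ * M₁ + (f y : ℕ) % M₁ = f y := Nat.div_add_mod' _ _
      simp only [φ, e, (f y).2, dite_true, Fin.eta]
    have hnn : ∀ a ∈ Finset.range K,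
        0 ≤ if avgDist d x (φ a y) ≤ Δ then ∏ i, P (x i, y i) else 0 := by
      intro a _
      split_ifs
      · exact Finset.prod_nonneg fun i _ => hP _
      · exact le_rfl
    have := Finset.single_le_sum hnn hmem
    simpa only [heq] using this
  calc _ ≤ ∑ a ∈ Finset.range K, reconProb P d Δ (φ a) := hcover
    _ ≤ ∑ a ∈ Finset.range K, pc P d n R₁ Δ := Finset.sum_le_sum fun a _ => hφ a
    _ = _ := by simp [K]

/-- The ratio of message counts is at most 2 · 2^{n(R₂-R₁)} after rounding, and it is at least 1, so
the extra block at most doubles it; hence the 4. -/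
theorem pc_le_rpow_mul_pc [Nonempty Xh] (hP : ∀ p, 0 ≤ P p) (n : ℕ) {R₁ R₂ : ℝ} (hR₁ : 0 ≤ R₁)
    (h : R₁ ≤ R₂) (hpos : 0 ≤ pc P d n R₁ Δ) :
    pc P d n R₂ Δ ≤ (4 * 2 ^ ((n : ℝ) * (R₂ - R₁))) * pc P d n R₁ Δ := by
  refine (pc_le_mul_pc hP n hR₁ (hR₁.trans h)).trans (mul_le_mul_of_nonneg_right ?_ hpos)
  have h1 : (0 : ℝ) < numMessages n R₁ := by exact_mod_cast numMessages_pos n hR₁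
  have h12 : (numMessages n R₁ : ℝ) ≤ numMessages n R₂ := by exact_mod_cast numMessages_mono n h
  have h3 : ((numMessages n R₂ / numMessages n R₁ : ℕ) : ℝ) ≤
    (numMessages n R₂ : ℝ) / numMessages n R₁ := Nat.cast_div_le
  have h4 : (1 : ℝ) ≤ (numMessages n R₂ : ℝ) / numMessages n R₁ := (one_le_div h1).2 h12
  have h5 : (numMessages n R₂ : ℝ) / numMessages n R₁ ≤ 2 * 2 ^ ((n : ℝ) * (R₂ - R₁)) := by
    rw [div_le_iff₀ h1, mul_sub, Real.rpow_sub (by norm_num)]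
    have hp : (0 : ℝ) < 2 ^ ((n : ℝ) * R₁) := by positivity
    have hp2 : (0 : ℝ) < 2 ^ ((n : ℝ) * R₂) := by positivity
    have := rpow_le_two_mul_numMessages n hR₁
    calc (numMessages n R₂ : ℝ) ≤ 2 ^ ((n : ℝ) * R₂) := numMessages_le n R₂
      _ = (2 ^ ((n : ℝ) * R₂) / 2 ^ ((n : ℝ) * R₁)) * 2 ^ ((n : ℝ) * R₁) := by field_simp
      _ ≤ (2 ^ ((n : ℝ) * R₂) / 2 ^ ((n : ℝ) * R₁)) * (2 * numMessages n R₁) := by gcongr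
      _ = _ := by ring
  push_cast
  linarith

/-! ### The exponent: existence, monotonicity and Lipschitz bound -/

theorem exponentSeq_nonneg [Nonempty Xh] (hP : P ∈ stdSimplex ℝ (X × Y))
    (hd : ∀ x xh, 0 ≤ d x xh) (hΔ : deltaMin P d ≤ Δ) {R : ℝ} (hR : 0 ≤ R) (n : ℕ) :
    0 ≤ exponentSeq P d R Δ n := by
  have := Real.logb_nonpos (b := 2) (by norm_num) (pc_pos hP hd hΔ n hR).le (pc_le_one hP n hR)
  rw [exponentSeq, neg_mul, ← mul_neg]
  exact mul_nonneg (by positivity) (by linarith)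

theorem tendsto_exponentSeq [Nonempty Xh] (hP : P ∈ stdSimplex ℝ (X × Y))
    (hd : ∀ x xh, 0 ≤ d x xh) (hΔ : deltaMin P d ≤ Δ) {R : ℝ} (hR : 0 ≤ R) :
    Tendsto (exponentSeq P d R Δ) atTop (𝓝 (exponent P d R Δ)) := by
  have hsub : Subadditive fun n => -Real.logb 2 (pc P d n R Δ) := by
    intro m n
    have hm := pc_pos hP hd hΔ m hR
    have hn := pc_pos hP hd hΔ n hR
    have := Real.logb_le_logb_of_le (b := 2) (by norm_num) (mul_pos hm hn)
      (pc_mul_le hP.1 m n hR)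
    rw [Real.logb_mul hm.ne' hn.ne'] at this
    linarith
  have heq : exponentSeq P d R Δ = fun n : ℕ => -Real.logb 2 (pc P d n R Δ) / (n : ℝ) := by
    funext n
    rw [exponentSeq]
    ring
  -- `exponent` is a `limUnder`, so convergence to any value is enough.
  refine tendsto_nhds_limUnder ⟨hsub.lim, ?_⟩
  rw [heq]
  refine hsub.tendsto_lim ⟨0, ?_⟩
  rintro _ ⟨n, rfl⟩
  have := exponentSeq_nonneg hP hd hΔ hR n
  rwa [heq] at this

theorem exponent_nonneg [Nonempty Xh] (hP : P ∈ stdSimplex ℝ (X × Y))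
    (hd : ∀ x xh, 0 ≤ d x xh) (hΔ : deltaMin P d ≤ Δ) {R : ℝ} (hR : 0 ≤ R) :
    0 ≤ exponent P d R Δ :=
  ge_of_tendsto' (tendsto_exponentSeq hP hd hΔ hR) (exponentSeq_nonneg hP hd hΔ hR)

theorem exponent_antitone [Nonempty Xh] (hP : P ∈ stdSimplex ℝ (X × Y))
    (hd : ∀ x xh, 0 ≤ d x xh) (hΔ : deltaMin P d ≤ Δ) {R₁ R₂ : ℝ} (hR : 0 ≤ R₁) (h : R₁ ≤ R₂) :
    exponent P d R₂ Δ ≤ exponent P d R₁ Δ := by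
  refine le_of_tendsto_of_tendsto' (tendsto_exponentSeq hP hd hΔ (hR.trans h))
    (tendsto_exponentSeq hP hd hΔ hR) fun n => ?_
  have := Real.logb_le_logb_of_le (b := 2) (by norm_num) (pc_pos hP hd hΔ n hR)
    (pc_mono n hR h)
  rw [exponentSeq, exponentSeq, neg_mul, neg_mul, neg_le_neg_iff]
  gcongr

theorem exponent_sub_le [Nonempty Xh] (hP : P ∈ stdSimplex ℝ (X × Y))
    (hd : ∀ x xh, 0 ≤ d x xh) (hΔ : deltaMin P d ≤ Δ) {R₁ R₂ : ℝ} (hR : 0 ≤ R₁) (h : R₁ ≤ R₂) :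
    exponent P d R₁ Δ - exponent P d R₂ Δ ≤ R₂ - R₁ := by
  -- The numerator 2 is log₂ of the factor 4 in `pc_le_rpow_mul_pc`.
  have hlim : Tendsto (fun n : ℕ => R₂ - R₁ + 2 / (n : ℝ)) atTop (𝓝 (R₂ - R₁ + 0)) :=
    tendsto_const_nhds.add (tendsto_const_div_atTop_nhds_zero_nat 2)
  rw [add_zero] at hlim
  refine le_of_tendsto_of_tendsto ((tendsto_exponentSeq hP hd hΔ hR).sub
    (tendsto_exponentSeq hP hd hΔ (hR.trans h))) hlim ?_
  filter_upwards [eventually_gt_atTop 0] with n hn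
  have hn' : (0 : ℝ) < n := by exact_mod_cast hn
  have h1 := pc_pos hP hd hΔ n hR
  have h2 := pc_pos hP hd hΔ n (hR.trans h)
  have key := Real.logb_le_logb_of_le (b := 2) (by norm_num) h2
    (pc_le_rpow_mul_pc hP.1 n hR h h1.le)
  have h4 : Real.logb 2 4 = 2 := by
    rw [show (4 : ℝ) = 2 ^ (2 : ℝ) by norm_num]
    exact Real.logb_rpow (by norm_num) (by norm_num)
  rw [Real.logb_mul (by positivity) h1.ne', Real.logb_mul (by norm_num) (by positivity),
    Real.logb_rpow (by norm_num) (by norm_num), h4] at key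
  have : exponentSeq P d R₁ Δ n - exponentSeq P d R₂ Δ n =
      (Real.logb 2 (pc P d n R₂ Δ) - Real.logb 2 (pc P d n R₁ Δ)) / n := by
    rw [exponentSeq, exponentSeq]
    ring
  rw [this, div_le_iff₀ hn', add_mul, div_mul_cancel₀ _ hn'.ne']
  linarith

theorem abs_exponent_sub_le [Nonempty Xh] (hP : P ∈ stdSimplex ℝ (X × Y))
    (hd : ∀ x xh, 0 ≤ d x xh) (hΔ : deltaMin P d ≤ Δ) {R₁ R₂ : ℝ} (hR₁ : 0 ≤ R₁)
    (hR₂ : 0 ≤ R₂) :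
    |exponent P d R₁ Δ - exponent P d R₂ Δ| ≤ |R₁ - R₂| := by
  rcases le_total R₁ R₂ with h | h
  · rw [abs_of_nonneg (sub_nonneg.2 (exponent_antitone hP hd hΔ hR₁ h)), abs_sub_comm R₁,
      abs_of_nonneg (sub_nonneg.2 h)]
    exact exponent_sub_le hP hd hΔ hR₁ h
  · rw [abs_sub_comm, abs_of_nonneg (sub_nonneg.2 (exponent_antitone hP hd hΔ hR₂ h)),
      abs_of_nonneg (sub_nonneg.2 h)]
    exact exponent_sub_le hP hd hΔ hR₂ h

end RemoteCoding

namespace RemoteCoding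

/-! ### Gibbs' inequality and its equality case -/

section Gibbs

variable {ι : Type*} [Fintype ι] {Q r : ι → ℝ}

/-- This is log u ≤ u - 1 at u = b / a, scaled by a. -/
theorem mul_log_sub_mul_log_le {a b : ℝ} (ha : 0 ≤ a) (hb : 0 ≤ b) (h : 0 < a → 0 < b) :
    a * Real.log b - a * Real.log a ≤ b - a := by
  rcases ha.eq_or_lt with rfl | ha
  · simpa using hb
  · have := Real.log_le_sub_one_of_pos (div_pos (h ha) ha)
    rw [Real.log_div (h ha).ne' ha.ne'] at this
    calc a * Real.log b - a * Real.log a = a * (Real.log b - Real.log a) := by ring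
      _ ≤ a * (b / a - 1) := by gcongr
      _ = b - a := by field_simp

theorem eq_of_mul_log_sub_mul_log_eq {a b : ℝ} (ha : 0 ≤ a) (h : 0 < a → 0 < b)
    (heq : a * Real.log b - a * Real.log a = b - a) : a = b := by
  rcases ha.eq_or_lt with rfl | ha
  · simpa using heq
  · by_contra hne
    have hlt := Real.log_lt_sub_one_of_pos (div_pos (h ha) ha)
      (fun hd => hne ((div_eq_one_iff_eq ha.ne').1 hd).symm)
    rw [Real.log_div (h ha).ne' ha.ne'] at hlt
    have := mul_lt_mul_of_pos_left hlt ha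
    have e : a * (b / a - 1) = b - a := by field_simp
    linarith

/-- Gibbs' inequality. -/
theorem sum_mul_log_le (hQ : ∀ i, 0 ≤ Q i) (hr : ∀ i, 0 ≤ r i) (hsum : ∑ i, r i ≤ ∑ i, Q i)
    (hsupp : ∀ i, 0 < Q i → 0 < r i) :
    ∑ i, Q i * Real.log (r i) ≤ ∑ i, Q i * Real.log (Q i) := by
  have := Finset.sum_le_sum fun i (_ : i ∈ Finset.univ) =>
    mul_log_sub_mul_log_le (hQ i) (hr i) (hsupp i)
  rw [Finset.sum_sub_distrib, Finset.sum_sub_distrib] at this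
  linarith

/-- The equality case of Gibbs' inequality. -/
theorem eq_of_sum_mul_log_le (hQ : ∀ i, 0 ≤ Q i) (hr : ∀ i, 0 ≤ r i)
    (hsum : ∑ i, r i ≤ ∑ i, Q i) (hsupp : ∀ i, 0 < Q i → 0 < r i)
    (hle : ∑ i, Q i * Real.log (Q i) ≤ ∑ i, Q i * Real.log (r i)) : Q = r := by
  have hterm := fun i (_ : i ∈ Finset.univ) =>
    mul_log_sub_mul_log_le (hQ i) (hr i) (hsupp i)
  have heq := (Finset.sum_eq_sum_iff_of_le hterm).1 (by
    refine le_antisymm (Finset.sum_le_sum hterm) ?_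
    rw [Finset.sum_sub_distrib, Finset.sum_sub_distrib]
    linarith)
  exact funext fun i => eq_of_mul_log_sub_mul_log_eq (hQ i) (hsupp i) (heq i (Finset.mem_univ i))

end Gibbs

/-! ### Marginals of finite mass functions -/

section Marginal

variable {S T : Type*} [Fintype S] [Fintype T]

open Classical in
/-- The image of the mass function `q` under `π`. -/
noncomputable def marginal (π : T → S) (q : T → ℝ) (s : S) : ℝ := ∑ t, if π t = s then q t else 0

theorem sum_marginal_mul (π : T → S) (q : T → ℝ) (F : S → ℝ) :
    ∑ s, marginal π q s * F s = ∑ t, q t * F (π t) := by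
  classical
  simp only [marginal, Finset.sum_mul]
  rw [Finset.sum_comm]
  simp [ite_mul]

theorem sum_marginal (π : T → S) (q : T → ℝ) : ∑ s, marginal π q s = ∑ t, q t := by
  simpa using sum_marginal_mul π q fun _ => 1

omit [Fintype S] in
theorem marginal_nonneg (π : T → S) {q : T → ℝ} (hq : ∀ t, 0 ≤ q t) (s : S) :
    0 ≤ marginal π q s := by
  refine Finset.sum_nonneg fun t _ => ?_
  split_ifs
  exacts [hq t, le_rfl]

omit [Fintype S] in
theorem le_marginal (π : T → S) {q : T → ℝ} (hq : ∀ t, 0 ≤ q t) (t : T) :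
    q t ≤ marginal π q (π t) := by
  classical
  have := Finset.single_le_sum (f := fun u => if π u = π t then q u else 0)
    (fun u _ => by
      split_ifs
      exacts [hq u, le_rfl]) (Finset.mem_univ t)
  simpa [marginal] using this

omit [Fintype S] in
theorem continuous_marginal (π : T → S) (s : S) : Continuous fun q : T → ℝ => marginal π q s := by
  classical
  refine continuous_finsetSum _ fun t _ => ?_
  split_ifs
  exacts [continuous_apply t, continuous_const]

/-- Since t log t is continuous at 0, entropies of marginals pass to limits even where masses
vanish. -/
theorem continuous_sum_marginal_mul_log (π : T → S) :
    Continuous fun q : T → ℝ => ∑ s, marginal π q s * Real.log (marginal π q s) :=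
  continuous_finsetSum _ fun s _ => Real.continuous_mul_log.comp (continuous_marginal π s)

end Marginal

/-! ### Single-letter bounds from conditioning on success -/

section LetterLaw

variable {X Y Xh : Type*} [Fintype X] [Fintype Y] [Fintype Xh]

theorem marginal_snd_apply (q : X × Y × Xh → ℝ) (s : Y × Xh) :
    marginal (fun t : X × Y × Xh => t.2) q s = ∑ a, q (a, s) := by
  classical
  rw [marginal, Fintype.sum_prod_type]
  refine Finset.sum_congr rfl fun a _ => ?_
  exact (Finset.sum_eq_single s (fun u _ hu => if_neg hu) (by simp)).trans (if_pos rfl)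

theorem marginal_snd_snd_apply (q : X × Y × Xh → ℝ) (c : Xh) :
    marginal (fun t : X × Y × Xh => t.2.2) q c =
      ∑ b, marginal (fun t : X × Y × Xh => t.2) q (b, c) := by
  classical
  simp_rw [marginal_snd_apply]
  simp only [marginal, Fintype.sum_prod_type]
  rw [Finset.sum_comm]
  refine Finset.sum_congr rfl fun b _ => Finset.sum_congr rfl fun a _ => ?_
  rw [Finset.sum_eq_single c (fun u _ hu => if_neg hu) (by simp), if_pos rfl]

theorem marginal_snd_fst_apply (q : X × Y × Xh → ℝ) (b : Y) :
    marginal (fun t : X × Y × Xh => t.2.1) q b =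
      ∑ c, marginal (fun t : X × Y × Xh => t.2) q (b, c) := by
  classical
  simp_rw [marginal_snd_apply]
  simp only [marginal, Fintype.sum_prod_type]
  rw [Finset.sum_comm (s := Finset.univ (α := Xh))]
  refine Finset.sum_congr rfl fun a _ => ?_
  rw [Finset.sum_eq_single b (fun u _ hu => by simp [hu]) (by simp)]
  simp

/-- The law of the letter triple at a uniformly random position, when the block `ω` has law `Q`. -/
noncomputable def letterLaw {Ω T : Type*} [Fintype Ω] [Fintype T] {n : ℕ} (π : Fin n → Ω → T)
    (Q : Ω → ℝ) (t : T) : ℝ := (1 / (n : ℝ)) * ∑ i, marginal (π i) Q t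

theorem sum_letterLaw_mul {Ω T : Type*} [Fintype Ω] [Fintype T] {n : ℕ} (π : Fin n → Ω → T)
    (Q : Ω → ℝ) (F : T → ℝ) :
    ∑ t, letterLaw π Q t * F t = (1 / (n : ℝ)) * ∑ ω, Q ω * ∑ i, F (π i ω) := by
  simp only [letterLaw, mul_assoc, Finset.sum_mul]
  rw [← Finset.mul_sum, Finset.sum_comm]
  simp_rw [sum_marginal_mul, Finset.mul_sum]
  rw [Finset.sum_comm]

theorem letterLaw_nonneg {Ω T : Type*} [Fintype Ω] [Fintype T] {n : ℕ} (π : Fin n → Ω → T)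
    {Q : Ω → ℝ} (hQ : ∀ ω, 0 ≤ Q ω) (t : T) : 0 ≤ letterLaw π Q t :=
  mul_nonneg (by positivity) (Finset.sum_nonneg fun i _ => marginal_nonneg _ hQ t)

theorem letterLaw_pos {Ω T : Type*} [Fintype Ω] [Fintype T] {n : ℕ} (π : Fin n → Ω → T)
    {Q : Ω → ℝ} (hQ : ∀ ω, 0 ≤ Q ω) {ω : Ω} (hω : 0 < Q ω) (i : Fin n) :
    0 < letterLaw π Q (π i ω) := by
  have hn : (0 : ℝ) < n := by exact_mod_cast i.pos
  refine mul_pos (by positivity) (Finset.sum_pos' (fun j _ => marginal_nonneg _ hQ _)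
    ⟨i, Finset.mem_univ _, hω.trans_le (le_marginal _ hQ ω)⟩)

theorem exists_pos_of_letterLaw_pos {Ω T : Type*} [Fintype Ω] [Fintype T] {n : ℕ}
    (π : Fin n → Ω → T) {Q : Ω → ℝ} (hQ : ∀ ω, 0 ≤ Q ω) {t : T} (ht : letterLaw π Q t ≠ 0) :
    ∃ ω i, 0 < Q ω ∧ π i ω = t := by
  classical
  obtain ⟨i, -, hi⟩ := Finset.exists_ne_zero_of_sum_ne_zero (right_ne_zero_of_mul ht)
  obtain ⟨ω, -, hω⟩ := Finset.exists_ne_zero_of_sum_ne_zero hi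
  by_cases h : π i ω = t
  · rw [if_pos h] at hω
    exact ⟨ω, i, (hQ ω).lt_of_ne' hω, h⟩
  · exact absurd (if_neg h) hω

theorem letterLaw_mem_stdSimplex {Ω T : Type*} [Fintype Ω] [Fintype T] {n : ℕ} (hn : 0 < n)
    (π : Fin n → Ω → T) {Q : Ω → ℝ} (hQ : Q ∈ stdSimplex ℝ Ω) :
    letterLaw π Q ∈ stdSimplex ℝ T := by
  refine ⟨letterLaw_nonneg π hQ.1, ?_⟩
  have hn' : (n : ℝ) ≠ 0 := by exact_mod_cast hn.ne'
  have := sum_letterLaw_mul π Q fun _ => 1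
  simp only [mul_one, Finset.sum_const, Finset.card_univ, Fintype.card_fin, nsmul_eq_mul,
    ← Finset.sum_mul, hQ.2, one_mul] at this
  rw [this]
  field_simp

/-- The letter triple at position `i` when the reconstruction is a function `z` of the second
sequence. -/
def triple {n : ℕ} (z : (Fin n → Y) → (Fin n → Xh)) (i : Fin n)
    (ω : (Fin n → X) × (Fin n → Y)) : X × Y × Xh := (ω.1 i, ω.2 i, z ω.2 i)

open Classical in
/-- The block law conditioned on the reconstruction being within distortion `Δ`. -/
noncomputable def successLaw (P : X × Y → ℝ) (d : X → Xh → ℝ) (Δ : ℝ) {n : ℕ}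
    (z : (Fin n → Y) → (Fin n → Xh)) (ω : (Fin n → X) × (Fin n → Y)) : ℝ :=
  (if avgDist d ω.1 (z ω.2) ≤ Δ then ∏ i, P (ω.1 i, ω.2 i) else 0) / reconProb P d Δ z

variable {P : X × Y → ℝ} {d : X → Xh → ℝ} {Δ : ℝ} {n : ℕ} {z : (Fin n → Y) → (Fin n → Xh)}

omit [Fintype Xh] in
theorem successLaw_mem_stdSimplex (hP : ∀ p, 0 ≤ P p) (hpos : 0 < reconProb P d Δ z) :
    successLaw P d Δ z ∈ stdSimplex ℝ ((Fin n → X) × (Fin n → Y)) := by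
  classical
  refine ⟨fun ω => div_nonneg ?_ hpos.le, ?_⟩
  · split_ifs
    exacts [Finset.prod_nonneg fun i _ => hP _, le_rfl]
  · simp only [successLaw]
    rw [← Finset.sum_div, div_eq_one_iff_eq hpos.ne', reconProb, Fintype.sum_prod_type]

-- On its support the success law is the i.i.d. law divided by a constant, so its log-likelihood is
-- a sum over positions plus a constant.
omit [Fintype Xh] in
theorem of_successLaw_pos (hP : ∀ p, 0 ≤ P p) {ω : (Fin n → X) × (Fin n → Y)}
    (hω : 0 < successLaw P d Δ z ω) :
    avgDist d ω.1 (z ω.2) ≤ Δ ∧ (∀ i, 0 < P (ω.1 i, ω.2 i)) ∧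
      successLaw P d Δ z ω = (∏ i, P (ω.1 i, ω.2 i)) / reconProb P d Δ z := by
  have h : avgDist d ω.1 (z ω.2) ≤ Δ := by
    by_contra h
    simp [successLaw, h] at hω
  refine ⟨h, fun i => (hP _).lt_of_ne' fun hi => ?_, by rw [successLaw, if_pos h]⟩
  rw [successLaw, if_pos h, Finset.prod_eq_zero (Finset.mem_univ i) hi, zero_div] at hω
  exact hω.false

/-- Recorded because log 0 = 0 here: off the support of P, the term log P would not penalise q. -/
theorem letterLaw_successLaw_eq_zero (hP : ∀ p, 0 ≤ P p) (hpos : 0 < reconProb P d Δ z)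
    {t : X × Y × Xh} (ht : P (t.1, t.2.1) = 0) :
    letterLaw (triple z) (successLaw P d Δ z) t = 0 := by
  by_contra hne
  obtain ⟨ω, i, hω, rfl⟩ :=
    exists_pos_of_letterLaw_pos _ (successLaw_mem_stdSimplex hP hpos).1 hne
  exact ((of_successLaw_pos hP hω).2.1 i).ne' ht

theorem sum_letterLaw_successLaw_dist_le (hn : 0 < n) (hP : ∀ p, 0 ≤ P p)
    (hpos : 0 < reconProb P d Δ z) :
    ∑ t, letterLaw (triple z) (successLaw P d Δ z) t * d t.1 t.2.2 ≤ Δ := by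
  have hn' : (0 : ℝ) < n := by exact_mod_cast hn
  have hQ := successLaw_mem_stdSimplex (d := d) (Δ := Δ) (z := z) hP hpos
  have hle : ∑ ω, successLaw P d Δ z ω * ∑ i, d (ω.1 i) (z ω.2 i) ≤
      ∑ ω, successLaw P d Δ z ω * (n * Δ) := by
    refine Finset.sum_le_sum fun ω _ => ?_
    rcases (hQ.1 ω).eq_or_lt with h | h
    · simp [← h]
    · exact mul_le_mul_of_nonneg_left (sum_le_of_avgDist_le (of_successLaw_pos hP h).1) h.le
  rw [← Finset.sum_mul, hQ.2, one_mul] at hle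
  rw [sum_letterLaw_mul _ _ fun t : X × Y × Xh => d t.1 t.2.2, one_div, inv_mul_le_iff₀ hn']
  exact hle

/-- Comparison of the success law with an unnormalised product-form law of mass at most `C`. -/
theorem sum_letterLaw_mul_log_le (hn : 0 < n) (hP : ∀ p, 0 ≤ P p)
    (hpos : 0 < reconProb P d Δ z) {k : X × Y × Xh → ℝ} (hk : ∀ t, 0 ≤ k t) {C : ℝ} (hC : 0 < C)
    (hsum : ∑ y : Fin n → Y, ∑ x : Fin n → X, ∏ i, k (x i, y i, z y i) ≤ C)
    (hsupp : ∀ t, 0 < letterLaw (triple z) (successLaw P d Δ z) t → 0 < k t) :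
    ∑ t, letterLaw (triple z) (successLaw P d Δ z) t * (Real.log (k t) - Real.log (P (t.1, t.2.1)))
      ≤ (Real.log C - Real.log (reconProb P d Δ z)) / n := by
  have hn' : (0 : ℝ) < n := by exact_mod_cast hn
  have hQ := successLaw_mem_stdSimplex (d := d) (Δ := Δ) (z := z) hP hpos
  have hkω : ∀ ω, 0 < successLaw P d Δ z ω → ∀ i, 0 < k (triple z i ω) := fun ω hω i =>
    hsupp _ (letterLaw_pos _ hQ.1 hω i)
  -- Gibbs on blocks, against the product measure normalised by its mass bound `C`.
  have hG := sum_mul_log_le (Q := successLaw P d Δ z)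
    (r := fun ω => (∏ i, k (triple z i ω)) / C) hQ.1
    (fun ω => div_nonneg (Finset.prod_nonneg fun i _ => hk _) hC.le)
    (by
      rw [hQ.2, ← Finset.sum_div, div_le_one hC, Fintype.sum_prod_type_right]
      exact hsum)
    (fun ω hω => div_pos (Finset.prod_pos fun i _ => hkω ω hω i) hC)
  have hterm : ∀ ω, successLaw P d Δ z ω * ∑ i, (Real.log (k (triple z i ω)) -
      Real.log (P (ω.1 i, ω.2 i))) =
      successLaw P d Δ z ω * Real.log ((∏ i, k (triple z i ω)) / C) -
        successLaw P d Δ z ω * Real.log (successLaw P d Δ z ω) +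
        successLaw P d Δ z ω * (Real.log C - Real.log (reconProb P d Δ z)) := by
    intro ω
    rcases (hQ.1 ω).eq_or_lt with h | h
    · simp [← h]
    · obtain ⟨-, h1, h2⟩ := of_successLaw_pos hP h
      have e : Real.log (successLaw P d Δ z ω) =
          ∑ i, Real.log (P (ω.1 i, ω.2 i)) - Real.log (reconProb P d Δ z) := by
        rw [h2, Real.log_div (Finset.prod_pos fun i _ => h1 i).ne' hpos.ne',
          Real.log_prod fun i _ => (h1 i).ne']
      rw [e, Real.log_div (Finset.prod_pos fun i _ => hkω ω h i).ne' hC.ne',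
        Real.log_prod fun i _ => (hkω ω h i).ne', Finset.sum_sub_distrib]
      ring
  rw [sum_letterLaw_mul _ _ fun t : X × Y × Xh => Real.log (k t) - Real.log (P (t.1, t.2.1)),
    one_div, inv_mul_le_iff₀ hn', mul_div_cancel₀ _ hn'.ne']
  refine (Finset.sum_congr rfl fun ω _ => hterm ω).trans_le ?_
  rw [Finset.sum_add_distrib, Finset.sum_sub_distrib, ← Finset.sum_mul, hQ.2, one_mul]
  linarith

theorem sum_prod_eq {A : Type*} [Fintype A] (h : Fin n → A → ℝ) :
    ∑ x : Fin n → A, ∏ i, h i (x i) = ∏ i, ∑ a, h i a := by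
  classical
  rw [Finset.prod_univ_sum, Fintype.piFinset_univ]

/-- Only an inequality: if the total is 0, the quotients are 0. Conditioning on null events
therefore never breaks the mass bounds. -/
theorem sum_div_le_one {A : Type*} [Fintype A] (h : A → ℝ) : ∑ a, h a / ∑ b, h b ≤ 1 := by
  rw [← Finset.sum_div]
  exact div_self_le_one _

/-- Conditioning on success costs `-(1/n) log p_c` in divergence from the Markov law
`P_{XY} q_{X̂|Y}`. -/
theorem letterLaw_divergence_le (hn : 0 < n) (hP : ∀ p, 0 ≤ P p)
    (hpos : 0 < reconProb P d Δ z) {q : X × Y × Xh → ℝ}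
    (hq : q = letterLaw (triple z) (successLaw P d Δ z)) :
    ∑ t, q t * (Real.log (q t) + Real.log (marginal (fun t : X × Y × Xh => t.2.1) q t.2.1) -
      Real.log (marginal (fun t : X × Y × Xh => t.2) q t.2) - Real.log (P (t.1, t.2.1))) ≤
      - Real.log (reconProb P d Δ z) / n := by
  have hmem : q ∈ stdSimplex ℝ (X × Y × Xh) :=
    hq ▸ letterLaw_mem_stdSimplex hn _ (successLaw_mem_stdSimplex hP hpos)
  set mY := marginal (fun t : X × Y × Xh => t.2.1) q
  set mYZ := marginal (fun t : X × Y × Xh => t.2) q with hmYZ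
  have hmY0 : ∀ b, 0 ≤ mY b := marginal_nonneg _ hmem.1
  have hmYZ0 : ∀ s, 0 ≤ mYZ s := marginal_nonneg _ hmem.1
  have hmYpos : ∀ t, 0 < q t → 0 < mY t.2.1 := fun t ht => ht.trans_le (le_marginal _ hmem.1 t)
  have hmYZpos : ∀ t, 0 < q t → 0 < mYZ t.2 := fun t ht => ht.trans_le (le_marginal _ hmem.1 t)
  -- The comparison kernel is q_{X|YX̂} q_Y. As `z` depends only on `y`, summing over `x` first
  -- removes the conditional factor, leaving mass at most 1.
  have key := sum_letterLaw_mul_log_le hn hP hpos (C := 1)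
    (k := fun t => q t / mYZ t.2 * mY t.2.1)
    (fun t => mul_nonneg (div_nonneg (hmem.1 t) (hmYZ0 _)) (hmY0 _)) one_pos
    (by
      have h1 : ∀ y : Fin n → Y, ∑ x : Fin n → X,
          ∏ i, (q (x i, y i, z y i) / mYZ (y i, z y i) * mY (y i)) ≤ ∏ i, mY (y i) := by
        intro y
        rw [sum_prod_eq fun i a => q (a, y i, z y i) / mYZ (y i, z y i) * mY (y i)]
        refine Finset.prod_le_prod (fun i _ => Finset.sum_nonneg fun a _ =>
          mul_nonneg (div_nonneg (hmem.1 _) (hmYZ0 _)) (hmY0 _)) fun i _ => ?_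
        rw [← Finset.sum_mul, hmYZ, marginal_snd_apply]
        exact mul_le_of_le_one_left (hmY0 _) (sum_div_le_one _)
      refine (Finset.sum_le_sum fun y _ => h1 y).trans ?_
      rw [sum_prod_eq fun _ => mY, sum_marginal, hmem.2]
      simp)
    (fun t ht => by
      rw [← hq] at ht
      exact mul_pos (div_pos ht (hmYZpos t ht)) (hmYpos t ht))
  rw [← hq, Real.log_one, zero_sub] at key
  refine le_trans (le_of_eq (Finset.sum_congr rfl fun t _ => ?_)) key
  rcases (hmem.1 t).eq_or_lt with h | h
  · simp [← h]
  · rw [Real.log_mul (div_pos h (hmYZpos t h)).ne' (hmYpos t h).ne',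
      Real.log_div h.ne' (hmYZpos t h).ne']
    ring

/-- Conditioning on success costs `-(1/n) log p_c` in rate. -/
theorem letterLaw_information_le {M : ℕ} {f : (Fin n → Y) → Fin M} {g : Fin M → (Fin n → Xh)}
    (hz : z = fun y => g (f y)) (hM : 0 < M) (hn : 0 < n) (hP : ∀ p, 0 ≤ P p)
    (hpos : 0 < reconProb P d Δ z) {q : X × Y × Xh → ℝ}
    (hq : q = letterLaw (triple z) (successLaw P d Δ z)) :
    ∑ t, q t * (Real.log (marginal (fun t : X × Y × Xh => t.2) q t.2) -
      Real.log (marginal (fun t : X × Y × Xh => t.2.2) q t.2.2) -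
      Real.log (∑ a, P (a, t.2.1))) ≤
      (Real.log M - Real.log (reconProb P d Δ z)) / n := by
  have hmem : q ∈ stdSimplex ℝ (X × Y × Xh) :=
    hq ▸ letterLaw_mem_stdSimplex hn _ (successLaw_mem_stdSimplex hP hpos)
  set mZ := marginal (fun t : X × Y × Xh => t.2.2) q with hmZ
  set mYZ := marginal (fun t : X × Y × Xh => t.2) q with hmYZ
  have hmZ0 : ∀ b, 0 ≤ mZ b := marginal_nonneg _ hmem.1
  have hmYZ0 : ∀ s, 0 ≤ mYZ s := marginal_nonneg _ hmem.1
  have hmZpos : ∀ t, 0 < q t → 0 < mZ t.2.2 := fun t ht => ht.trans_le (le_marginal _ hmem.1 t)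
  have hmYZpos : ∀ t, 0 < q t → 0 < mYZ t.2 := fun t ht => ht.trans_le (le_marginal _ hmem.1 t)
  have hPpos : ∀ t, 0 < q t → 0 < P (t.1, t.2.1) := fun t ht => (hP _).lt_of_ne' fun h0 =>
    ht.ne' (hq ▸ letterLaw_successLaw_eq_zero hP hpos h0)
  have hPY0 : ∀ b, 0 ≤ ∑ a, P (a, b) := fun b => Finset.sum_nonneg fun a _ => hP _
  have hPYpos : ∀ t, 0 < q t → 0 < ∑ a, P (a, t.2.1) := fun t ht =>
    Finset.sum_pos' (fun a _ => hP _) ⟨t.1, Finset.mem_univ _, hPpos t ht⟩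
  have hℓ0 : ∀ s : Y × Xh, 0 ≤ mYZ s / mZ s.2 := fun s => div_nonneg (hmYZ0 _) (hmZ0 _)
  -- The comparison kernel is P_{X|Y} q_{Y|X̂}; each fixed codeword contributes mass at most 1.
  have key := sum_letterLaw_mul_log_le hn hP hpos (C := M)
    (k := fun t => P (t.1, t.2.1) / (∑ a, P (a, t.2.1)) * (mYZ t.2 / mZ t.2.2))
    (fun t => mul_nonneg (div_nonneg (hP _) (hPY0 _)) (hℓ0 _)) (by exact_mod_cast hM)
    (by
      have h1 : ∀ y : Fin n → Y, ∑ x : Fin n → X,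
          ∏ i, (P (x i, y i) / (∑ a, P (a, y i)) * (mYZ (y i, z y i) / mZ (z y i))) ≤
            ∏ i, (mYZ (y i, z y i) / mZ (z y i)) := by
        intro y
        rw [sum_prod_eq fun i a =>
          P (a, y i) / (∑ a, P (a, y i)) * (mYZ (y i, z y i) / mZ (z y i))]
        refine Finset.prod_le_prod (fun i _ => Finset.sum_nonneg fun a _ =>
          mul_nonneg (div_nonneg (hP _) (hPY0 _)) (hℓ0 (y i, z y i))) fun i _ => ?_
        rw [← Finset.sum_mul]
        exact mul_le_of_le_one_left (hℓ0 (y i, z y i)) (sum_div_le_one _)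
      have h2 : ∀ c : Fin n → Xh, ∑ y : Fin n → Y, ∏ i, (mYZ (y i, c i) / mZ (c i)) ≤ 1 := by
        intro c
        rw [sum_prod_eq fun i b => mYZ (b, c i) / mZ (c i)]
        refine Finset.prod_le_one (fun i _ => Finset.sum_nonneg fun b _ => hℓ0 (b, c i))
          fun i _ => ?_
        rw [hmZ, marginal_snd_snd_apply]
        exact sum_div_le_one _
      calc _ ≤ ∑ y : Fin n → Y, ∏ i, (mYZ (y i, z y i) / mZ (z y i)) :=
            Finset.sum_le_sum fun y _ => h1 y
        -- Summing over all codewords frees the codeword from its dependence on `y`; this is where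
        -- the number of messages enters.
        _ ≤ ∑ y : Fin n → Y, ∑ m, ∏ i, (mYZ (y i, g m i) / mZ (g m i)) := by
            refine Finset.sum_le_sum fun y _ => ?_
            rw [hz]
            exact Finset.single_le_sum
              (f := fun m => ∏ i, (mYZ (y i, g m i) / mZ (g m i)))
              (fun m _ => Finset.prod_nonneg fun i _ => hℓ0 (y i, g m i))
              (Finset.mem_univ (f y))
        _ ≤ ∑ _m : Fin M, (1 : ℝ) := by
            rw [Finset.sum_comm]
            exact Finset.sum_le_sum fun m _ => h2 (g m)
        _ = M := by simp)
    (fun t ht => by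
      rw [← hq] at ht
      exact mul_pos (div_pos (hPpos t ht) (hPYpos t ht)) (div_pos (hmYZpos t ht) (hmZpos t ht)))
  rw [← hq] at key
  refine le_trans (le_of_eq (Finset.sum_congr rfl fun t _ => ?_)) key
  rcases (hmem.1 t).eq_or_lt with h | h
  · simp [← h]
  · rw [Real.log_mul (div_pos (hPpos t h) (hPYpos t h)).ne'
        (div_pos (hmYZpos t h) (hmZpos t h)).ne',
      Real.log_div (hPpos t h).ne' (hPYpos t h).ne',
      Real.log_div (hmYZpos t h).ne' (hmZpos t h).ne']
    ring

end LetterLaw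

end RemoteCoding

/-! ### Compactness and positivity below the remote rate-distortion function -/

namespace RemoteCoding

variable {X Y Xh : Type*} [Fintype X] [Fintype Y] [Fintype Xh]
  {P : X × Y → ℝ} {d : X → Xh → ℝ} {Δ : ℝ}

/-- The divergence (in nats) of `q` from the law `P_{XY} q_{X̂|Y}`, as a combination of entropies. -/
noncomputable def markovDivergence (P : X × Y → ℝ) (q : X × Y × Xh → ℝ) : ℝ :=
  ∑ t, q t * Real.log (q t) +
    ∑ b, marginal (fun t : X × Y × Xh => t.2.1) q b *
      Real.log (marginal (fun t : X × Y × Xh => t.2.1) q b) -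
    ∑ s, marginal (fun t : X × Y × Xh => t.2) q s *
      Real.log (marginal (fun t : X × Y × Xh => t.2) q s) -
    ∑ t, q t * Real.log (P (t.1, t.2.1))

/-- The divergence (in nats) of the law of `(Y, X̂)` under `q` from `P_Y q_{X̂}`, as a combination of
entropies. -/
noncomputable def outputDivergence (P : X × Y → ℝ) (q : X × Y × Xh → ℝ) : ℝ :=
  ∑ s, marginal (fun t : X × Y × Xh => t.2) q s *
      Real.log (marginal (fun t : X × Y × Xh => t.2) q s) -
    ∑ c, marginal (fun t : X × Y × Xh => t.2.2) q c *
      Real.log (marginal (fun t : X × Y × Xh => t.2.2) q c) -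
    ∑ t, q t * Real.log (∑ a, P (a, t.2.1))

theorem continuous_markovDivergence :
    Continuous (markovDivergence (Xh := Xh) P) := by
  refine Continuous.sub (Continuous.sub (Continuous.add ?_ (continuous_sum_marginal_mul_log _))
    (continuous_sum_marginal_mul_log _)) ?_
  · exact continuous_finsetSum _ fun t _ => Real.continuous_mul_log.comp (continuous_apply t)
  · exact continuous_finsetSum _ fun t _ => (continuous_apply t).mul continuous_const

theorem continuous_outputDivergence :
    Continuous (outputDivergence (Xh := Xh) P) := by
  refine Continuous.sub (Continuous.sub (continuous_sum_marginal_mul_log _)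
    (continuous_sum_marginal_mul_log _)) ?_
  exact continuous_finsetSum _ fun t _ => (continuous_apply t).mul continuous_const

theorem markovDivergence_eq (q : X × Y × Xh → ℝ) :
    markovDivergence P q = ∑ t, q t * (Real.log (q t) +
      Real.log (marginal (fun t : X × Y × Xh => t.2.1) q t.2.1) -
      Real.log (marginal (fun t : X × Y × Xh => t.2) q t.2) - Real.log (P (t.1, t.2.1))) := by
  rw [markovDivergence, sum_marginal_mul _ q fun b => Real.log (marginal _ q b),
    sum_marginal_mul _ q fun s => Real.log (marginal _ q s)]
  simp only [mul_add, mul_sub, Finset.sum_add_distrib, Finset.sum_sub_distrib]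

theorem outputDivergence_eq (q : X × Y × Xh → ℝ) :
    outputDivergence P q = ∑ t, q t * (
      Real.log (marginal (fun t : X × Y × Xh => t.2) q t.2) -
      Real.log (marginal (fun t : X × Y × Xh => t.2.2) q t.2.2) -
      Real.log (∑ a, P (a, t.2.1))) := by
  rw [outputDivergence, sum_marginal_mul _ q fun b => Real.log (marginal _ q b),
    sum_marginal_mul _ q fun s => Real.log (marginal _ q s)]
  simp only [mul_sub, Finset.sum_sub_distrib]

/-- The letter laws that are within distortion `Δ` and absolutely continuous with respect to `P`. -/
def feasibleLaws (P : X × Y → ℝ) (d : X → Xh → ℝ) (Δ : ℝ) : Set (X × Y × Xh → ℝ) :=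
  {q | q ∈ stdSimplex ℝ (X × Y × Xh) ∧ (∀ t, P (t.1, t.2.1) = 0 → q t = 0) ∧
    ∑ t, q t * d t.1 t.2.2 ≤ Δ}

/-- Absolute continuity with respect to the fixed P is the vanishing of prescribed coordinates, a
closed condition. -/
theorem isCompact_feasibleLaws : IsCompact (feasibleLaws P d Δ) := by
  have h : feasibleLaws P d Δ = stdSimplex ℝ (X × Y × Xh) ∩
      ((⋂ t, ⋂ _ : P (t.1, t.2.1) = 0, {q | q t = 0}) ∩ {q | ∑ t, q t * d t.1 t.2.2 ≤ Δ}) := by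
    ext q
    simp only [feasibleLaws, Set.mem_inter_iff, Set.mem_iInter]
    rfl
  rw [h]
  refine (isCompact_stdSimplex ℝ (X × Y × Xh)).inter_right (IsClosed.inter ?_ ?_)
  · exact isClosed_iInter fun t => isClosed_iInter fun _ =>
      isClosed_eq (continuous_apply t) continuous_const
  · exact isClosed_le (continuous_finsetSum _ fun t _ => (continuous_apply t).mul continuous_const)
      continuous_const

/-- A code of block length `n` yields a letter law whose two divergences are controlled by the
exponent of its success probability. -/
theorem exists_feasibleLaw [Nonempty Xh] (hP : P ∈ stdSimplex ℝ (X × Y))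
    (hd : ∀ x xh, 0 ≤ d x xh) (hΔ : deltaMin P d ≤ Δ) {R : ℝ} (hR : 0 ≤ R) {n : ℕ} (hn : 0 < n) :
    ∃ q ∈ feasibleLaws P d Δ, markovDivergence P q ≤ exponentSeq P d R Δ n * Real.log 2 ∧
      outputDivergence P q ≤ (R + exponentSeq P d R Δ n) * Real.log 2 := by
  obtain ⟨f, g, h⟩ := exists_reconProb_eq_pc (P := P) (d := d) (Δ := Δ) n hR
  have hpos : 0 < reconProb P d Δ (fun y => g (f y)) := h ▸ pc_pos hP hd hΔ n hR
  have hn' : (0 : ℝ) < n := by exact_mod_cast hn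
  have hlog2 : 0 < Real.log 2 := Real.log_pos (by norm_num)
  have hM := numMessages_pos n hR
  have hexp : exponentSeq P d R Δ n * Real.log 2 =
      -Real.log (reconProb P d Δ (fun y => g (f y))) / n := by
    rw [h, exponentSeq, Real.logb]
    field_simp
  refine ⟨letterLaw (triple fun y => g (f y)) (successLaw P d Δ fun y => g (f y)),
    ⟨letterLaw_mem_stdSimplex hn _ (successLaw_mem_stdSimplex hP.1 hpos),
      fun t => letterLaw_successLaw_eq_zero hP.1 hpos,
      sum_letterLaw_successLaw_dist_le hn hP.1 hpos⟩, ?_, ?_⟩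
  · rw [markovDivergence_eq, hexp]
    exact letterLaw_divergence_le hn hP.1 hpos rfl
  · rw [outputDivergence_eq, add_mul, hexp]
    refine (letterLaw_information_le rfl hM hn hP.1 hpos rfl).trans ?_
    have hlogM : Real.log (numMessages n R) ≤ n * R * Real.log 2 := by
      rw [← Real.log_rpow (by norm_num)]
      exact Real.log_le_log (by exact_mod_cast hM) (numMessages_le n R)
    rw [div_le_iff₀ hn', add_mul, div_mul_cancel₀ _ hn'.ne']
    linarith

/-- A feasible law with vanishing Markov divergence comes from a feasible channel. -/
theorem remoteRateDistortion_le [Nonempty Xh] (hP : P ∈ stdSimplex ℝ (X × Y)) {R : ℝ}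
    (hR : 0 ≤ R) {q : X × Y × Xh → ℝ} (hq : q ∈ feasibleLaws P d Δ)
    (hmarkov : markovDivergence P q ≤ 0) (hout : outputDivergence P q ≤ R * Real.log 2) :
    remoteRateDistortion P d Δ ≤ R := by
  classical
  obtain ⟨hmem, hsupp, hdist⟩ := hq
  set mY := marginal (fun t : X × Y × Xh => t.2.1) q with hmY
  set mYZ := marginal (fun t : X × Y × Xh => t.2) q with hmYZ
  set mZ := marginal (fun t : X × Y × Xh => t.2.2) q with hmZ
  have hmY0 : ∀ b, 0 ≤ mY b := marginal_nonneg _ hmem.1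
  have hmYZ0 : ∀ s, 0 ≤ mYZ s := marginal_nonneg _ hmem.1
  have hmYpos : ∀ t, 0 < q t → 0 < mY t.2.1 := fun t ht => ht.trans_le (le_marginal _ hmem.1 t)
  have hmYZpos : ∀ t, 0 < q t → 0 < mYZ t.2 := fun t ht => ht.trans_le (le_marginal _ hmem.1 t)
  have hPpos : ∀ t, 0 < q t → 0 < P (t.1, t.2.1) := fun t ht => (hP.1 _).lt_of_ne' fun h0 =>
    ht.ne' (hsupp t h0)
  -- The conditional law q_{X̂|Y}; where q_Y vanishes any pmf serves, and a point mass keeps the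
  -- total mass of P_XY W equal to 1.
  let W : Y → Xh → ℝ := fun b c =>
    if mY b = 0 then (Pi.single (Classical.arbitrary Xh) 1 : Xh → ℝ) c else mYZ (b, c) / mY b
  have hW : ∀ b, W b ∈ stdSimplex ℝ Xh := by
    intro b
    by_cases hb : mY b = 0
    · have : W b = Pi.single (Classical.arbitrary Xh) 1 := funext fun c => if_pos hb
      rw [this]
      exact single_mem_stdSimplex ℝ _
    · have : W b = fun c => mYZ (b, c) / mY b := funext fun c => if_neg hb
      rw [this]
      refine ⟨fun c => div_nonneg (hmYZ0 _) (hmY0 _), ?_⟩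
      rw [← Finset.sum_div, hmYZ, ← marginal_snd_fst_apply]
      exact div_self hb
  have hWpos : ∀ t, 0 < q t → W t.2.1 t.2.2 = mYZ t.2 / mY t.2.1 := fun t ht =>
    if_neg (hmYpos t ht).ne'
  have hsumr : ∑ t : X × Y × Xh, P (t.1, t.2.1) * W t.2.1 t.2.2 = 1 := by
    rw [← hP.2, Fintype.sum_prod_type, Fintype.sum_prod_type]
    refine Finset.sum_congr rfl fun a _ => ?_
    rw [Fintype.sum_prod_type]
    refine Finset.sum_congr rfl fun b _ => ?_
    dsimp only
    rw [← Finset.mul_sum, (hW b).2, mul_one]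
  have hqr : q = fun t => P (t.1, t.2.1) * W t.2.1 t.2.2 := by
    refine eq_of_sum_mul_log_le hmem.1 (fun t => mul_nonneg (hP.1 _) ((hW _).1 _))
      (hsumr.trans hmem.2.symm).le (fun t ht => ?_) ?_
    · rw [hWpos t ht]
      exact mul_pos (hPpos t ht) (div_pos (hmYZpos t ht) (hmYpos t ht))
    -- The entropy gap between q and P_XY W is exactly `markovDivergence P q`.
    · rw [← sub_nonpos, ← Finset.sum_sub_distrib]
      refine le_trans (le_of_eq (Finset.sum_congr rfl fun t _ => ?_))
        ((markovDivergence_eq q).symm.trans_le hmarkov)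
      rcases (hmem.1 t).eq_or_lt with h | h
      · simp [← h]
      · rw [hWpos t h, Real.log_mul (hPpos t h).ne' (div_pos (hmYZpos t h) (hmYpos t h)).ne',
          Real.log_div (hmYZpos t h).ne' (hmYpos t h).ne']
        ring
  have hfeas : W ∈ feasibleChannels P d Δ := by
    refine ⟨hW, le_trans (le_of_eq ?_) hdist⟩
    simp only [Fintype.sum_prod_type]
    refine Finset.sum_congr rfl fun a _ => Finset.sum_congr rfl fun b _ =>
      Finset.sum_congr rfl fun c _ => ?_
    rw [hqr]
  have hjoint : jointYXh P W = mYZ := by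
    funext s
    rw [hmYZ, marginal_snd_apply, jointYXh, Finset.sum_mul]
    refine Finset.sum_congr rfl fun a _ => ?_
    rw [hqr]
  -- With q_Y = P_Y, the output divergence becomes the mutual information.
  have hPY : ∀ b, ∑ c, mYZ (b, c) = ∑ a, P (a, b) := by
    intro b
    rw [← hjoint]
    simp only [jointYXh]
    rw [← Finset.mul_sum, (hW b).2, mul_one]
  have hinfo : mutualInfo (jointYXh P W) ≤ R := by
    have hlog2 : 0 < Real.log 2 := Real.log_pos (by norm_num)
    rw [← mul_le_mul_iff_of_pos_right hlog2]
    refine le_trans (le_of_eq ?_) hout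
    rw [outputDivergence_eq, ← hmYZ, ← hmZ, ← sum_marginal_mul _ q fun s : Y × Xh =>
      Real.log (mYZ s) - Real.log (mZ s.2) - Real.log (∑ a, P (a, s.1)), ← hmYZ, hjoint,
      mutualInfo, ← Fintype.sum_prod_type' (f := fun a b => mYZ (a, b) * Real.logb 2
        (mYZ (a, b) / ((∑ b', mYZ (a, b')) * (∑ a', mYZ (a', b))))), Finset.sum_mul]
    refine Finset.sum_congr rfl fun s _ => ?_
    rcases (hmYZ0 s).eq_or_lt with h | h
    · simp [← h]
    · have h1 : 0 < ∑ c, mYZ (s.1, c) :=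
        Finset.sum_pos' (fun c _ => hmYZ0 _) ⟨s.2, Finset.mem_univ _, h⟩
      have h2 : 0 < ∑ b, mYZ (b, s.2) :=
        Finset.sum_pos' (fun b _ => hmYZ0 _) ⟨s.1, Finset.mem_univ _, h⟩
      rw [Real.logb, mul_assoc, div_mul_cancel₀ _ hlog2.ne', Real.log_div h.ne' (mul_pos h1 h2).ne',
        Real.log_mul h1.ne' h2.ne', hPY, hmZ, marginal_snd_snd_apply]
      ring
  by_cases hbdd : BddBelow ((fun W => mutualInfo (jointYXh P W)) '' feasibleChannels P d Δ)
  · exact (csInf_le hbdd ⟨W, hfeas, rfl⟩).trans hinfo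
  -- The real infimum defaults to 0 here, which spares proving that mutual information is
  -- nonnegative.
  · rw [remoteRateDistortion, Real.sInf_of_not_bddBelow hbdd]
    exact hR

/-- A zero exponent would let a subsequence of letter laws converge to a feasible law; both
divergences are continuous, so their bounds become 0 and R log 2 in the limit. -/
theorem exponent_pos [Nonempty Xh] (hP : P ∈ stdSimplex ℝ (X × Y))
    (hd : ∀ x xh, 0 ≤ d x xh) (hΔ : deltaMin P d ≤ Δ) {R : ℝ} (hR : 0 ≤ R)
    (hlt : R < remoteRateDistortion P d Δ) : 0 < exponent P d R Δ := by
  refine (exponent_nonneg hP hd hΔ hR).lt_of_ne' fun h0 => hlt.not_ge ?_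
  choose q hq hmarkov hout using fun n : ℕ =>
    exists_feasibleLaw hP hd hΔ hR (Nat.succ_pos n)
  obtain ⟨q₀, hq₀, φ, hφ, hlim⟩ := isCompact_feasibleLaws.tendsto_subseq hq
  have hε : Tendsto (fun k => exponentSeq P d R Δ (φ k + 1)) atTop (𝓝 0) :=
    h0 ▸ (tendsto_exponentSeq hP hd hΔ hR).comp
      ((tendsto_add_atTop_nat 1).comp hφ.tendsto_atTop)
  refine remoteRateDistortion_le hP hR hq₀ ?_ ?_
  · have h1 := (continuous_markovDivergence (P := P) (Xh := Xh)).continuousAt.tendsto.comp hlim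
    have h2 := hε.mul_const (Real.log 2)
    rw [zero_mul] at h2
    exact le_of_tendsto_of_tendsto' h1 h2 fun k => hmarkov (φ k)
  · have h1 := (continuous_outputDivergence (P := P) (Xh := Xh)).continuousAt.tendsto.comp hlim
    have h2 := (hε.const_add R).mul_const (Real.log 2)
    rw [add_zero] at h2
    exact le_of_tendsto_of_tendsto' h1 h2 fun k => hout (φ k)

end RemoteCoding

theorem proposition1 {X Y Xh : Type*} [Fintype X] [Fintype Y] [Fintype Xh] [Nonempty Xh]
    (P : X × Y → ℝ) (hP : P ∈ stdSimplex ℝ (X × Y))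
    (d : X → Xh → ℝ) (hd : ∀ x xh, 0 ≤ d x xh)
    (Δ : ℝ) (hΔ : RemoteCoding.deltaMin P d ≤ Δ) :
    (∀ R : ℝ, 0 ≤ R →
      (∀ n : ℕ, 1 ≤ n → 0 < RemoteCoding.pc P d n R Δ) ∧
      Tendsto (RemoteCoding.exponentSeq P d R Δ) atTop (𝓝 (RemoteCoding.exponent P d R Δ))) ∧
    ContinuousOn (fun R : ℝ => RemoteCoding.exponent P d R Δ) (Set.Ici 0) ∧
    (∀ R₁ R₂ : ℝ, 0 ≤ R₁ → 0 ≤ R₂ →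
      |RemoteCoding.exponent P d R₁ Δ - RemoteCoding.exponent P d R₂ Δ| ≤ |R₁ - R₂|) ∧
    (∀ R : ℝ, 0 ≤ R → R < RemoteCoding.remoteRateDistortion P d Δ →
      0 < RemoteCoding.exponent P d R Δ) := by
  refine ⟨fun R hR => ⟨fun n _ => RemoteCoding.pc_pos hP hd hΔ n hR,
    RemoteCoding.tendsto_exponentSeq hP hd hΔ hR⟩, ?_,
    fun R₁ R₂ h₁ h₂ => RemoteCoding.abs_exponent_sub_le hP hd hΔ h₁ h₂,
    fun R hR hlt => RemoteCoding.exponent_pos hP hd hΔ hR hlt⟩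
  refine (LipschitzOnWith.of_dist_le_mul (K := 1) fun R₁ h₁ R₂ h₂ => ?_).continuousOn
  simpa [Real.dist_eq] using RemoteCoding.abs_exponent_sub_le hP hd hΔ h₁ h₂
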